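/- Let $\tilde H^2$ be the closed subspace of all $f\in L^2[-1/2,1/2]$ with $\int_{-1/2}^{1/2} f(x)e^{-2\pi i n x}\,dx=0$ for every integer $n<0$, and let $P_+:L^2[-1/2,1/2]\to\tilde H^2$ be the orthogonal (Riesz) projection. For $\phi\in L^\infty[-1/2,1/2]$ the Toeplitz operator with symbol $\phi$ is the bounded operator $T_\phi:\tilde H^2\to\tilde H^2$, $T_\phi f=P_+(\phi f)$. A bounded operator $T$ on $\tilde H^2$ is called norm-bounded below if there is $c>0$ with $\|Tf\|\ge c\|f\|$ for all $f\in\tilde H^2$, and invertible if it has a bounded two-sided inverse. Let $\xi\in\mathbb{R}$ and $g_\xi(x)=e^{2\pi i\xi x}$ for $x\in[-1/2,1/2]$. Then: 1. $T_{g_\xi}$ is not injective if $\xi<-1/2$. 2. $T_{g_\xi}$ is invertible if $-1/2<\xi<1/2$. 3. $T_{g_\xi}$ is injective but not norm-bounded below if $\xi=-1/2+n$ for some $n\in\{0,1,2,\dots\}$. 4. $T_{g_\xi}$ is injective and norm-bounded below but not surjective if $\xi>1/2$ and $\xi\neq-1/2+n$ for all $n\in\{0,1,2,\dots\}$. -/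

import Mathlib

open MeasureTheory
open scoped ENNReal

noncomputable section

namespace ToeplitzExp

/-- Lebesgue measure on the interval `[-1/2, 1/2]`. -/
abbrev intervalMeasure : Measure ℝ :=
  volume.restrict (Set.Icc (-(1 / 2) : ℝ) (1 / 2))

/-- The function `g_ξ(x) = e^{2πiξx}` of a real variable. -/
def expFun (ξ : ℝ) (x : ℝ) : ℂ :=
  Complex.exp (2 * Real.pi * Complex.I * ξ * x)

theorem memLp_expFun (p : ℝ≥0∞) (ξ : ℝ) : MemLp (expFun ξ) p intervalMeasure := by
  refine MemLp.of_bound (C := 1) ?_ (Filter.Eventually.of_forall fun x => ?_)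
  · have h : Continuous (expFun ξ) := by
      unfold expFun
      fun_prop
    exact h.aestronglyMeasurable
  · have h : (2 * Real.pi * Complex.I * ξ * x : ℂ)
        = ((2 * Real.pi * ξ * x : ℝ) : ℂ) * Complex.I := by
      push_cast
      ring
    rw [expFun, h, Complex.norm_exp_ofReal_mul_I]

/-- The class of `g_ξ` in `L^p[-1/2, 1/2]`. -/
def expLp (p : ℝ≥0∞) (ξ : ℝ) : Lp ℂ p intervalMeasure :=
  (memLp_expFun p ξ).toLp (expFun ξ)

/-- The Hardy space: all `f` in `L²[-1/2, 1/2]` whose Fourier coefficients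
`⟨f, e^{2πinx}⟩ = ∫ f(x) e^{-2πinx} dx` vanish for every negative integer `n`.
(Mathlib's inner product is conjugate-linear in its first argument.) -/
def hardySpace : Submodule ℂ (Lp ℂ 2 intervalMeasure) where
  carrier := {f | ∀ n : ℤ, n < 0 → inner ℂ (expLp 2 n) f = 0}
  zero_mem' := fun n _ => inner_zero_right _
  add_mem' := fun {f g} hf hg n hn => by
    rw [inner_add_right, hf n hn, hg n hn, add_zero]
  smul_mem' := fun c f hf n hn => by
    rw [inner_smul_right, hf n hn, mul_zero]

theorem isClosed_hardySpace : IsClosed (hardySpace : Set (Lp ℂ 2 intervalMeasure)) := by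
  have h : (hardySpace : Set (Lp ℂ 2 intervalMeasure))
      = ⋂ n : ℤ, ⋂ _ : n < 0, {f | inner ℂ (expLp 2 n) f = 0} := by
    ext f
    simp [hardySpace]
  rw [h]
  exact isClosed_iInter fun n => isClosed_iInter fun _ =>
    isClosed_eq (continuous_const.inner continuous_id) continuous_const

instance instCompleteSpaceHardySpace : CompleteSpace hardySpace :=
  isClosed_hardySpace.completeSpace_coe

/-- Multiplication by `φ ∈ L^∞[-1/2, 1/2]` as a bounded operator on `L²[-1/2, 1/2]`. -/
def mulOp (φ : Lp ℂ ∞ intervalMeasure) :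
    Lp ℂ 2 intervalMeasure →L[ℂ] Lp ℂ 2 intervalMeasure :=
  (ContinuousLinearMap.mul ℂ ℂ).holderL intervalMeasure ∞ 2 2 φ

/-- The Toeplitz operator `T_φ f = P₊(φ f)` on the Hardy space, where `P₊` is the orthogonal
(Riesz) projection of `L²[-1/2, 1/2]` onto the Hardy space. -/
def toeplitz (φ : Lp ℂ ∞ intervalMeasure) : hardySpace →L[ℂ] hardySpace :=
  hardySpace.orthogonalProjectionOnto ∘L mulOp φ ∘L hardySpace.subtypeL

/-- A bounded operator is norm-bounded below if `c ‖f‖ ≤ ‖T f‖` for all `f`, for some `c > 0`. -/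
def NormBoundedBelow {H : Type*} [NormedAddCommGroup H] [NormedSpace ℂ H] (T : H →L[ℂ] H) : Prop :=
  ∃ c : ℝ, 0 < c ∧ ∀ f : H, c * ‖f‖ ≤ ‖T f‖

end ToeplitzExp

end

/-
The Toeplitz operators satisfy `T_{ξ+n} = T_ξ T_n` and `T_{ξ-n} = T_{-n} T_ξ` for natural `n`, where
`T_n` is an isometric shift, so that everything reduces to the strip `|ξ| ≤ 1/2` and to `ξ < -1`.

* `|ξ| < 1/2`: on `[-1/2, 1/2]` the function `cos(πξ) g_ξ` stays within `|sin(πξ)| < 1` of the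
  constant `1`, so `T_ξ` is invertible by a Neumann series. For `n ≥ 1` the factorization
  `T_{ξ+n} = T_ξ T_n` then gives injectivity, the lower bound and the failure of surjectivity.
* `ξ < -1`: on the unit circle `conj (1 + z) = z⁻¹ (1 + z)`, hence `F z = (1 + z) ^ (-ξ - 1)` has
  `g_ξ F = conj (z F)`. The latter has only negative frequencies, so `F` lies in the kernel.
  For `-1 ≤ ξ < -1/2` the kernel of `T_{-1}`, the constants, is hit by the invertible `T_{ξ+1}`.
* `ξ = -1/2`: if `f` is in the kernel, then `f²` has only nonnegative frequencies, while
  `g_{-1} f² = (g_{-1/2} f)²` has only frequencies `≤ -2`, so `f² = 0`. A lower bound for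
  `T_{-1/2}` would persist for nearby symbols, but `T_ξ` is not injective for `ξ < -1/2`.
  Since the range of `T_1` has codimension one, a lower bound for `T_{ξ+1} = T_ξ T_1` forces one
  for the injective operator `T_ξ`, which carries the failure over to `-1/2 + n`.
-/

open Filter Topology Set
open scoped BoundedContinuousFunction NNReal

namespace ToeplitzExp

section FourierUniqueness

theorem ae_eq_zero_of_forall_integral_boundedContinuous_smul_eq_zero {X E : Type*}
    [TopologicalSpace X] [HasOuterApproxClosed X] [MeasurableSpace X] [BorelSpace X]
    [NormedAddCommGroup E] [NormedSpace ℝ E] [CompleteSpace E] {μ : Measure X} {f : X → E}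
    (hf : Integrable f μ) (h : ∀ φ : X →ᵇ ℝ≥0, ∫ x, φ x • f x ∂μ = 0) : f =ᵐ[μ] 0 := by
  refine ae_eq_zero_of_forall_setIntegral_isClosed_eq_zero hf fun F hF => ?_
  rw [← integral_indicator hF.measurableSet]
  refine tendsto_nhds_unique (f := fun n => ∫ x, hF.apprSeq n x • f x ∂μ) (l := atTop) ?_ ?_
  · refine tendsto_integral_of_dominated_convergence (fun x => ‖f x‖) (fun n => ?_) hf.norm
      (fun n => ae_of_all _ fun x => ?_) (ae_of_all _ fun x => ?_)
    · exact (hF.apprSeq n).continuous.aestronglyMeasurable.smul hf.aestronglyMeasurable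
    · rw [NNReal.smul_def, norm_smul, NNReal.norm_eq]
      exact mul_le_of_le_one_left (norm_nonneg _) (HasOuterApproxClosed.apprSeq_apply_le_one hF n x)
    · convert! (tendsto_pi_nhds.1 (HasOuterApproxClosed.tendsto_apprSeq hF) x).smul_const (f x)
        using 2
      by_cases hx : x ∈ F <;> simp [hx]
  · simp only [h, tendsto_const_nhds]

variable {E : Type*} [NormedAddCommGroup E] [NormedSpace ℂ E] [CompleteSpace E]

theorem integral_smul_eq_zero_of_fourierCoeff_eq_zero {T : ℝ} [Fact (0 < T)] {f : AddCircle T → E}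
    (hf : Integrable f AddCircle.haarAddCircle) (h : ∀ n, fourierCoeff f n = 0)
    (φ : C(AddCircle T, ℂ)) : ∫ t, φ t • f t ∂AddCircle.haarAddCircle = 0 := by
  let Λ : C(AddCircle T, ℂ) →L[ℂ] E :=
    ((ContinuousLinearMap.lsmul ℂ ℂ).lpPairing AddCircle.haarAddCircle ∞ 1).flip
      ((memLp_one_iff_integrable.2 hf).toLp f) ∘L
      ContinuousMap.toLp ∞ AddCircle.haarAddCircle ℂ
  have hΛ (ψ) : Λ ψ = ∫ t, ψ t • f t ∂AddCircle.haarAddCircle := by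
    refine (ContinuousLinearMap.lpPairing_eq_integral _ _ _).trans (integral_congr_ae ?_)
    filter_upwards [ContinuousMap.coeFn_toLp (p := ∞) (𝕜 := ℂ) AddCircle.haarAddCircle ψ,
      (memLp_one_iff_integrable.2 hf).coeFn_toLp] with t hψ hft
    rw [hft]
    exact congrArg (· • f t) hψ
  have hspan : Submodule.span ℂ (range (@fourier T)) ≤ Λ.ker := by
    rw [Submodule.span_le]
    rintro _ ⟨n, rfl⟩
    have hn := h (-n)
    rw [fourierCoeff, neg_neg] at hn
    exact (hΛ _).trans hn
  have hker := Submodule.topologicalClosure_minimal _ hspan Λ.isClosed_ker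
  rw [span_fourier_closure_eq_top] at hker
  exact (hΛ φ).symm.trans (hker Submodule.mem_top)

theorem ae_eq_zero_of_fourierCoeff_eq_zero {T : ℝ} [Fact (0 < T)] {f : AddCircle T → E}
    (hf : Integrable f AddCircle.haarAddCircle) (h : ∀ n, fourierCoeff f n = 0) :
    f =ᵐ[AddCircle.haarAddCircle] 0 := by
  let : NormedSpace ℝ E := NormedSpace.restrictScalars ℝ ℂ E
  refine ae_eq_zero_of_forall_integral_boundedContinuous_smul_eq_zero hf fun φ => ?_
  rw [← integral_smul_eq_zero_of_fourierCoeff_eq_zero hf h ⟨fun t => ((φ t : ℝ) : ℂ), by fun_prop⟩]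
  rfl

theorem ae_eq_zero_of_fourierCoeffOn_eq_zero {a b : ℝ} (hab : a < b) {f : ℝ → ℂ}
    (hf : IntegrableOn f (Ioc a b)) (h : ∀ n, fourierCoeffOn hab f n = 0) :
    f =ᵐ[volume.restrict (Ioc a b)] 0 := by
  have : Fact (0 < b - a) := ⟨sub_pos.2 hab⟩
  have hb : a + (b - a) = b := add_sub_cancel a b
  have hlift : MemLp (AddCircle.liftIoc (b - a) a f) 1 :=
    MemLp.memLp_liftIoc (by rwa [hb, memLp_one_iff_integrable])
  have hzero : AddCircle.liftIoc (b - a) a f =ᵐ[volume] 0 :=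
    Measure.smul_absolutelyContinuous.ae_le
      (ae_eq_zero_of_fourierCoeff_eq_zero (memLp_one_iff_integrable.1 hlift.haarAddCircle) h)
  have hmk := (AddCircle.measurePreserving_mk (b - a) a).quasiMeasurePreserving.ae hzero
  rw [hb] at hmk
  filter_upwards [hmk, ae_restrict_mem measurableSet_Ioc] with x hx hxab
  rwa [AddCircle.liftIoc_coe_apply (by rwa [hb])] at hx

end FourierUniqueness

section Exponential

theorem expFun_eq_exp_mul_I (ξ x : ℝ) :
    expFun ξ x = Complex.exp ((2 * Real.pi * ξ * x : ℝ) * Complex.I) := by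
  rw [expFun]
  congr 1
  push_cast
  ring

theorem expFun_add (ξ η x : ℝ) : expFun (ξ + η) x = expFun ξ x * expFun η x := by
  rw [expFun, expFun, expFun, ← Complex.exp_add]
  congr 1
  push_cast
  ring

theorem expFun_zero (x : ℝ) : expFun 0 x = 1 := by
  simp [expFun]

theorem expFun_natCast (n : ℕ) (x : ℝ) : expFun n x = expFun 1 x ^ n := by
  rw [expFun, expFun, ← Complex.exp_nat_mul]
  congr 1
  push_cast
  ring

theorem conj_expFun (ξ x : ℝ) : starRingEnd ℂ (expFun ξ x) = expFun (-ξ) x := by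
  rw [expFun_eq_exp_mul_I, expFun_eq_exp_mul_I, ← Complex.exp_conj]
  congr 1
  simp [map_ofNat]

theorem norm_expFun (ξ x : ℝ) : ‖expFun ξ x‖ = 1 := by
  rw [expFun_eq_exp_mul_I, Complex.norm_exp_ofReal_mul_I]

theorem continuous_expFun (ξ : ℝ) : Continuous (expFun ξ) := by
  unfold expFun
  fun_prop

theorem integral_intervalMeasure_eq_intervalIntegral {E : Type*} [NormedAddCommGroup E]
    [NormedSpace ℝ E] (f : ℝ → E) :
    ∫ x, f x ∂intervalMeasure = ∫ x in (-(1 / 2) : ℝ)..(1 / 2), f x := by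
  rw [integral_Icc_eq_integral_Ioc, intervalIntegral.integral_of_le (by norm_num)]

theorem integral_expFun_intCast {n : ℤ} (hn : n ≠ 0) : ∫ x, expFun n x ∂intervalMeasure = 0 := by
  have hc : (2 * Real.pi * Complex.I * (n : ℝ) : ℂ) ≠ 0 :=
    mul_ne_zero Complex.two_pi_I_ne_zero (by exact_mod_cast hn)
  simp only [integral_intervalMeasure_eq_intervalIntegral, expFun]
  rw [integral_exp_mul_complex hc, div_eq_zero_iff, sub_eq_zero]
  refine .inl (Complex.exp_eq_exp_iff_exists_int.2 ⟨n, ?_⟩)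
  push_cast
  ring

theorem integral_comp_expFun_one {E : Type*} [NormedAddCommGroup E] [NormedSpace ℝ E] (f : ℂ → E) :
    ∫ x, f (expFun 1 x) ∂intervalMeasure = Real.circleAverage f 0 1 := by
  have hcircle (x : ℝ) : expFun 1 x = circleMap 0 1 (2 * Real.pi * x + Real.pi + -Real.pi) := by
    rw [expFun_eq_exp_mul_I, circleMap]
    simp
  rw [integral_intervalMeasure_eq_intervalIntegral, Real.circleAverage_eq_integral_add (-Real.pi)]
  simp_rw [hcircle]
  rw [intervalIntegral.integral_comp_mul_add
    (fun θ => f (circleMap 0 1 (θ + -Real.pi))) (by positivity)]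
  ring_nf

theorem ae_eq_zero_of_integral_expFun_mul_eq_zero {f : ℝ → ℂ} (hf : Integrable f intervalMeasure)
    (h : ∀ n : ℤ, ∫ x, expFun n x * f x ∂intervalMeasure = 0) : f =ᵐ[intervalMeasure] 0 := by
  have hhalf : -(1 / 2 : ℝ) < 1 / 2 := by norm_num
  rw [intervalMeasure, ← restrict_Ioc_eq_restrict_Icc] at hf ⊢
  refine ae_eq_zero_of_fourierCoeffOn_eq_zero hhalf hf fun n => ?_
  have hfourier (x : ℝ) :
      fourier (-n) (x : AddCircle (1 / 2 - -(1 / 2) : ℝ)) = expFun (-n : ℤ) x := by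
    rw [fourier_coe_apply, expFun]
    congr 1
    push_cast
    ring
  simp_rw [fourierCoeffOn_eq_integral, hfourier, smul_eq_mul,
    ← integral_intervalMeasure_eq_intervalIntegral, h, smul_zero]

end Exponential

section Multiplication

theorem coeFn_expLp (p : ℝ≥0∞) (ξ : ℝ) : expLp p ξ =ᵐ[intervalMeasure] expFun ξ :=
  (memLp_expFun p ξ).coeFn_toLp

theorem coeFn_mulOp (φ : Lp ℂ ∞ intervalMeasure) (f : Lp ℂ 2 intervalMeasure) :
    mulOp φ f =ᵐ[intervalMeasure] fun x => φ x * f x :=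
  (ContinuousLinearMap.mul ℂ ℂ).coeFn_holder φ f

theorem norm_mulOp_le (φ : Lp ℂ ∞ intervalMeasure) : ‖mulOp φ‖ ≤ ‖φ‖ := by
  refine ContinuousLinearMap.opNorm_le_bound _ (norm_nonneg φ) fun f => ?_
  refine ((ContinuousLinearMap.mul ℂ ℂ).norm_holder_apply_apply_le φ f).trans ?_
  rw [ContinuousLinearMap.opNorm_mul, one_mul]

theorem coeFn_mulOp_expLp (ξ : ℝ) (f : Lp ℂ 2 intervalMeasure) :
    mulOp (expLp ∞ ξ) f =ᵐ[intervalMeasure] fun x => expFun ξ x * f x := by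
  filter_upwards [coeFn_mulOp (expLp ∞ ξ) f, coeFn_expLp ∞ ξ] with x hmul hexp
  rw [hmul, hexp]

theorem mulOp_expLp_add (ξ η : ℝ) (f : Lp ℂ 2 intervalMeasure) :
    mulOp (expLp ∞ (ξ + η)) f = mulOp (expLp ∞ ξ) (mulOp (expLp ∞ η) f) := by
  apply Lp.ext
  filter_upwards [coeFn_mulOp_expLp (ξ + η) f, coeFn_mulOp_expLp η f,
    coeFn_mulOp_expLp ξ (mulOp (expLp ∞ η) f)] with x hsum hη hξ
  rw [hsum, hξ, hη, expFun_add, mul_assoc]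

theorem mulOp_expLp_zero (f : Lp ℂ 2 intervalMeasure) : mulOp (expLp ∞ 0) f = f := by
  apply Lp.ext
  filter_upwards [coeFn_mulOp_expLp 0 f] with x hx
  rw [hx, expFun_zero, one_mul]

theorem mulOp_expLp_expLp (ξ η : ℝ) : mulOp (expLp ∞ ξ) (expLp 2 η) = expLp 2 (ξ + η) := by
  apply Lp.ext
  filter_upwards [coeFn_mulOp_expLp ξ (expLp 2 η), coeFn_expLp 2 η, coeFn_expLp 2 (ξ + η)]
    with x hmul hη hsum
  rw [hmul, hη, hsum, expFun_add]

theorem norm_mulOp_expLp (ξ : ℝ) (f : Lp ℂ 2 intervalMeasure) : ‖mulOp (expLp ∞ ξ) f‖ = ‖f‖ := by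
  have hnorm : ∀ᵐ x ∂intervalMeasure, ‖mulOp (expLp ∞ ξ) f x‖ = ‖f x‖ := by
    filter_upwards [coeFn_mulOp_expLp ξ f] with x hx
    rw [hx, norm_mul, norm_expFun, one_mul]
  exact le_antisymm (Lp.norm_le_norm_of_ae_le (hnorm.mono fun _ => le_of_eq))
    (Lp.norm_le_norm_of_ae_le (hnorm.mono fun _ => ge_of_eq))

theorem inner_mulOp_expLp (ξ : ℝ) (f g : Lp ℂ 2 intervalMeasure) :
    inner ℂ f (mulOp (expLp ∞ ξ) g) = inner ℂ (mulOp (expLp ∞ (-ξ)) f) g := by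
  rw [L2.inner_def, L2.inner_def]
  apply integral_congr_ae
  filter_upwards [coeFn_mulOp_expLp ξ g, coeFn_mulOp_expLp (-ξ) f] with x hg hf
  rw [hg, hf, RCLike.inner_apply, RCLike.inner_apply, map_mul, conj_expFun, neg_neg]
  ring

theorem inner_expLp_mulOp (ξ η : ℝ) (f : Lp ℂ 2 intervalMeasure) :
    inner ℂ (expLp 2 η) (mulOp (expLp ∞ ξ) f) = inner ℂ (expLp 2 (η - ξ)) f := by
  rw [inner_mulOp_expLp, mulOp_expLp_expLp, neg_add_eq_sub]

theorem inner_expLp (ξ : ℝ) (f : Lp ℂ 2 intervalMeasure) :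
    inner ℂ (expLp 2 ξ) f = ∫ x, expFun (-ξ) x * f x ∂intervalMeasure := by
  rw [L2.inner_def]
  apply integral_congr_ae
  filter_upwards [coeFn_expLp 2 ξ] with x hx
  rw [hx, RCLike.inner_apply, conj_expFun, mul_comm]

theorem inner_star_left (f g : Lp ℂ 2 intervalMeasure) :
    inner ℂ (star f) g = ∫ x, f x * g x ∂intervalMeasure := by
  rw [L2.inner_def]
  apply integral_congr_ae
  filter_upwards [Lp.coeFn_star f] with x hx
  rw [hx, RCLike.inner_apply, Pi.star_apply, starRingEnd_apply, star_star, mul_comm]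

theorem inner_expLp_star (ξ : ℝ) (f : Lp ℂ 2 intervalMeasure) :
    inner ℂ (expLp 2 ξ) (star f) = starRingEnd ℂ (inner ℂ (expLp 2 (-ξ)) f) := by
  rw [inner_expLp, inner_expLp, ← integral_conj]
  apply integral_congr_ae
  filter_upwards [Lp.coeFn_star f] with x hx
  rw [hx, map_mul, conj_expFun, neg_neg, Pi.star_apply, starRingEnd_apply]

theorem norm_expLp_sub_smul_expLp_le {ξ η C : ℝ} {c : ℂ} (hC : 0 ≤ C)
    (h : ∀ x ∈ Icc (-(1 / 2) : ℝ) (1 / 2), ‖expFun ξ x - c * expFun η x‖ ≤ C) :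
    ‖expLp ∞ ξ - c • expLp ∞ η‖ ≤ C := by
  have hbound : ∀ᵐ x ∂intervalMeasure, ‖(expLp ∞ ξ - c • expLp ∞ η) x‖ ≤ C := by
    filter_upwards [coeFn_expLp ∞ ξ, coeFn_expLp ∞ η, Lp.coeFn_sub (expLp ∞ ξ) (c • expLp ∞ η),
      Lp.coeFn_smul c (expLp ∞ η), ae_restrict_mem measurableSet_Icc] with x hξ hη hsub hsmul hx
    rw [hsub, Pi.sub_apply, hsmul, Pi.smul_apply, hξ, hη, smul_eq_mul]
    exact h x hx
  simpa using Lp.norm_le_of_ae_bound hC hbound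

theorem norm_expLp_sub_expLp_le (ξ η : ℝ) : ‖expLp ∞ ξ - expLp ∞ η‖ ≤ Real.pi * |ξ - η| := by
  rw [← one_smul ℂ (expLp ∞ η)]
  refine norm_expLp_sub_smul_expLp_le (by positivity) fun x hx => ?_
  have hfactor : expFun ξ x - 1 * expFun η x = expFun η x * (expFun (ξ - η) x - 1) := by
    rw [mul_sub, ← expFun_add, add_sub_cancel, one_mul, mul_one]
  calc ‖expFun ξ x - 1 * expFun η x‖
      = ‖Complex.exp (Complex.I * (2 * Real.pi * (ξ - η) * x : ℝ)) - 1‖ := by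
        rw [hfactor, norm_mul, norm_expFun, one_mul, expFun_eq_exp_mul_I, mul_comm Complex.I]
    _ ≤ |2 * Real.pi * (ξ - η) * x| := Real.norm_exp_I_mul_ofReal_sub_one_le
    _ = Real.pi * |ξ - η| * (2 * |x|) := by
        rw [abs_mul, abs_mul, abs_mul, abs_two, abs_of_pos Real.pi_pos]
        ring
    _ ≤ Real.pi * |ξ - η| := by
        have hx_abs : |x| ≤ 1 / 2 := abs_le.2 hx
        exact mul_le_of_le_one_right (by positivity) (by linarith)

theorem continuous_expLp_top : Continuous fun ξ => expLp ∞ ξ := by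
  refine LipschitzWith.continuous (K := NNReal.pi) (LipschitzWith.of_dist_le_mul fun ξ η => ?_)
  rw [dist_eq_norm, Real.dist_eq]
  exact norm_expLp_sub_expLp_le ξ η

end Multiplication

section FourierBasis

theorem inner_eq_zero_of_forall_inner_basis_eq_zero {ι 𝕜 E : Type*} [RCLike 𝕜]
    [NormedAddCommGroup E] [InnerProductSpace 𝕜 E] (b : HilbertBasis ι 𝕜 E) {x y : E}
    (h : ∀ i, inner 𝕜 (b i) x = 0 ∨ inner 𝕜 (b i) y = 0) : inner 𝕜 x y = 0 := by
  rw [← b.tsum_inner_mul_inner x y]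
  refine (tsum_congr fun i => ?_).trans tsum_zero
  rw [mul_eq_zero, inner_eq_zero_symm]
  exact h i

theorem orthonormal_expLp : Orthonormal ℂ fun n : ℤ => expLp 2 n := by
  have hinner (m n : ℤ) : inner ℂ (expLp 2 m) (expLp 2 n)
      = ∫ x, expFun (n - m : ℤ) x ∂intervalMeasure := by
    rw [inner_expLp]
    refine integral_congr_ae ?_
    filter_upwards [coeFn_expLp 2 n] with x hx
    rw [hx, ← expFun_add, neg_add_eq_sub, Int.cast_sub]
  rw [orthonormal_iff_ite]
  intro m n
  rw [hinner]
  split_ifs with hmn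
  · simp only [hmn, sub_self, Int.cast_zero, expFun_zero]
    norm_num
  · exact integral_expFun_intCast (sub_ne_zero.2 (Ne.symm hmn))

theorem eq_zero_of_forall_inner_expLp_eq_zero {f : Lp ℂ 2 intervalMeasure}
    (h : ∀ n : ℤ, inner ℂ (expLp 2 n) f = 0) : f = 0 := by
  rw [Lp.eq_zero_iff_ae_eq_zero]
  refine ae_eq_zero_of_integral_expFun_mul_eq_zero
    ((Lp.memLp f).integrable (by norm_num)) fun n => ?_
  simpa [inner_expLp] using h (-n)

/-- The exponentials `e^{2πinx}`, `n ∈ ℤ`, as a Hilbert basis of `L²[-1/2, 1/2]`. -/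
noncomputable def expBasis : HilbertBasis ℤ ℂ (Lp ℂ 2 intervalMeasure) :=
  HilbertBasis.mkOfOrthogonalEqBot orthonormal_expLp <| by
    refine (Submodule.eq_bot_iff _).2 fun f hf => eq_zero_of_forall_inner_expLp_eq_zero fun n => ?_
    exact (Submodule.mem_orthogonal _ _).1 hf _ (Submodule.subset_span ⟨n, rfl⟩)

theorem inner_eq_zero_of_forall_inner_expLp_eq_zero {f g : Lp ℂ 2 intervalMeasure}
    (h : ∀ n : ℤ, inner ℂ (expLp 2 n) f = 0 ∨ inner ℂ (expLp 2 n) g = 0) : inner ℂ f g = 0 :=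
  inner_eq_zero_of_forall_inner_basis_eq_zero expBasis <| by
    simpa only [expBasis, HilbertBasis.coe_mkOfOrthogonalEqBot] using h

theorem integral_expFun_mul_mul_eq_zero (ξ η : ℝ) {f g : Lp ℂ 2 intervalMeasure}
    (h : ∀ n : ℤ, inner ℂ (expLp 2 (-n - ξ)) f = 0 ∨ inner ℂ (expLp 2 (n - η)) g = 0) :
    ∫ x, expFun (ξ + η) x * (f x * g x) ∂intervalMeasure = 0 := by
  calc ∫ x, expFun (ξ + η) x * (f x * g x) ∂intervalMeasure
      = inner ℂ (star (mulOp (expLp ∞ ξ) f)) (mulOp (expLp ∞ η) g) := by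
        rw [inner_star_left]
        refine integral_congr_ae ?_
        filter_upwards [coeFn_mulOp_expLp ξ f, coeFn_mulOp_expLp η g] with x hf hg
        rw [hf, hg, expFun_add]
        ring
    _ = 0 := by
        refine inner_eq_zero_of_forall_inner_expLp_eq_zero fun n => ?_
        rw [inner_expLp_star, map_eq_zero, inner_expLp_mulOp, inner_expLp_mulOp]
        exact h n

end FourierBasis

section ToeplitzAlgebra

theorem mem_orthogonal_hardySpace {f : Lp ℂ 2 intervalMeasure} :
    f ∈ hardySpaceᗮ ↔ ∀ n : ℕ, inner ℂ (expLp 2 n) f = 0 := by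
  refine ⟨fun h n => (Submodule.mem_orthogonal _ _).1 h _ fun m hm => ?_,
    fun h => (Submodule.mem_orthogonal _ _).2 fun u hu =>
      inner_eq_zero_of_forall_inner_expLp_eq_zero fun n => ?_⟩
  · exact_mod_cast orthonormal_expLp.2 (i := m) (j := n) (by omega)
  · rcases lt_or_ge n 0 with hn | hn
    · exact .inl (hu n hn)
    · lift n to ℕ using hn
      exact .inr (mod_cast h n)

/-- The exponential `e^{2πinx}` with `n ≥ 0` as an element of the Hardy space. -/
noncomputable def hardyExp (n : ℕ) : hardySpace :=
  ⟨expLp 2 n, fun m hm => mod_cast orthonormal_expLp.2 (i := m) (j := n) (by omega)⟩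

theorem toeplitz_apply (φ : Lp ℂ ∞ intervalMeasure) (f : hardySpace) :
    toeplitz φ f = hardySpace.orthogonalProjectionOnto (mulOp φ f) :=
  rfl

theorem toeplitz_sub (φ ψ : Lp ℂ ∞ intervalMeasure) :
    toeplitz (φ - ψ) = toeplitz φ - toeplitz ψ := by
  simp only [toeplitz, mulOp, map_sub, ContinuousLinearMap.sub_comp, ContinuousLinearMap.comp_sub]

theorem toeplitz_smul (c : ℂ) (φ : Lp ℂ ∞ intervalMeasure) :
    toeplitz (c • φ) = c • toeplitz φ := by
  simp only [toeplitz, mulOp, map_smul, ContinuousLinearMap.smul_comp,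
    ContinuousLinearMap.comp_smul]

theorem norm_toeplitz_le (φ : Lp ℂ ∞ intervalMeasure) : ‖toeplitz φ‖ ≤ ‖φ‖ :=
  ContinuousLinearMap.opNorm_le_bound _ (norm_nonneg φ) fun f =>
    calc ‖toeplitz φ f‖
        ≤ ‖mulOp φ f‖ := hardySpace.norm_orthogonalProjectionOnto_apply_le _
      _ ≤ ‖φ‖ * ‖f‖ := (mulOp φ).le_of_opNorm_le (norm_mulOp_le φ) f

theorem continuous_toeplitz : Continuous toeplitz := by
  refine LipschitzWith.continuous (f := toeplitz) (K := 1)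
    (LipschitzWith.of_dist_le_mul fun φ ψ => ?_)
  rw [dist_eq_norm, dist_eq_norm, NNReal.coe_one, one_mul, ← toeplitz_sub]
  exact norm_toeplitz_le (φ - ψ)

theorem toeplitz_expLp_eq_zero_iff {ξ : ℝ} {f : hardySpace} :
    toeplitz (expLp ∞ ξ) f = 0 ↔
      ∀ n : ℕ, inner ℂ (expLp 2 (n - ξ)) (f : Lp ℂ 2 intervalMeasure) = 0 := by
  simp only [toeplitz_apply, hardySpace.orthogonalProjectionOnto_eq_zero_iff,
    mem_orthogonal_hardySpace, inner_expLp_mulOp]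

theorem mulOp_natCast_mem_hardySpace (n : ℕ) {f : Lp ℂ 2 intervalMeasure} (hf : f ∈ hardySpace) :
    mulOp (expLp ∞ n) f ∈ hardySpace := by
  intro m hm
  rw [inner_expLp_mulOp]
  exact_mod_cast hf (m - n) (by omega)

theorem mulOp_neg_natCast_mem_orthogonal (n : ℕ) {f : Lp ℂ 2 intervalMeasure}
    (hf : f ∈ hardySpaceᗮ) : mulOp (expLp ∞ (-n)) f ∈ hardySpaceᗮ := by
  rw [Submodule.mem_orthogonal] at hf ⊢
  intro u hu
  rw [inner_mulOp_expLp, neg_neg]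
  exact hf _ (mulOp_natCast_mem_hardySpace n hu)

theorem coe_toeplitz_natCast (n : ℕ) (f : hardySpace) :
    (toeplitz (expLp ∞ n) f : Lp ℂ 2 intervalMeasure) = mulOp (expLp ∞ n) f :=
  congrArg Subtype.val (hardySpace.orthogonalProjectionOnto_mem_subspace_eq_self
    ⟨_, mulOp_natCast_mem_hardySpace n f.2⟩)

theorem norm_toeplitz_natCast (n : ℕ) (f : hardySpace) : ‖toeplitz (expLp ∞ n) f‖ = ‖f‖ := by
  rw [Submodule.coe_norm, coe_toeplitz_natCast, norm_mulOp_expLp, Submodule.coe_norm]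

theorem injective_toeplitz_natCast (n : ℕ) : Function.Injective (toeplitz (expLp ∞ n)) :=
  (AddMonoidHomClass.isometry_of_norm _ (norm_toeplitz_natCast n)).injective

theorem toeplitz_expLp_zero : toeplitz (expLp ∞ 0) = 1 := by
  ext1 f
  apply Subtype.ext
  simpa [mulOp_expLp_zero] using coe_toeplitz_natCast 0 f

theorem toeplitz_add_natCast (ξ : ℝ) (n : ℕ) :
    toeplitz (expLp ∞ (ξ + n)) = toeplitz (expLp ∞ ξ) ∘L toeplitz (expLp ∞ n) := by
  ext1 f
  rw [ContinuousLinearMap.comp_apply, toeplitz_apply, toeplitz_apply _ (toeplitz _ f),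
    coe_toeplitz_natCast, mulOp_expLp_add]

theorem toeplitz_neg_natCast_add (ξ : ℝ) (n : ℕ) :
    toeplitz (expLp ∞ (-n + ξ)) = toeplitz (expLp ∞ (-n)) ∘L toeplitz (expLp ∞ ξ) := by
  ext1 f
  rw [ContinuousLinearMap.comp_apply, toeplitz_apply, toeplitz_apply _ (toeplitz _ f),
    mulOp_expLp_add, ← sub_eq_zero, ← map_sub, ← map_sub,
    hardySpace.orthogonalProjectionOnto_eq_zero_iff, toeplitz_apply]
  exact mulOp_neg_natCast_mem_orthogonal n (hardySpace.sub_starProjection_mem_orthogonal _)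

theorem norm_hardyExp (n : ℕ) : ‖hardyExp n‖ = 1 := mod_cast orthonormal_expLp.1 n

theorem hardyExp_ne_zero (n : ℕ) : hardyExp n ≠ 0 :=
  norm_ne_zero_iff.1 ((norm_hardyExp n).trans_ne one_ne_zero)

theorem range_toeplitz_natCast_le {n : ℕ} (hn : 0 < n) :
    (toeplitz (expLp ∞ n)).range ≤ (ℂ ∙ hardyExp 0)ᗮ := by
  rintro _ ⟨f, rfl⟩
  rw [Submodule.mem_orthogonal_singleton_iff_inner_right, Submodule.coe_inner,
    ContinuousLinearMap.coe_coe, coe_toeplitz_natCast, hardyExp, inner_expLp_mulOp]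
  exact_mod_cast f.2 ((0 : ℕ) - n) (by omega)

theorem not_surjective_toeplitz_natCast {n : ℕ} (hn : 0 < n) :
    ¬ Function.Surjective (toeplitz (expLp ∞ n)) := fun hsurj =>
  hardyExp_ne_zero 0 <| Submodule.mem_bot ℂ |>.1 <|
    (Submodule.isCompl_orthogonal _).disjoint.le_bot
      ⟨Submodule.mem_span_singleton_self _, range_toeplitz_natCast_le hn (hsurj _)⟩

theorem orthogonal_span_hardyExp_zero_le_range_toeplitz_one :
    (ℂ ∙ hardyExp 0)ᗮ ≤ (toeplitz (expLp ∞ (1 : ℕ))).range := by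
  intro f hf
  rw [Submodule.mem_orthogonal_singleton_iff_inner_right] at hf
  have hmem : mulOp (expLp ∞ (-1)) (f : Lp ℂ 2 intervalMeasure) ∈ hardySpace := by
    intro n hn
    rw [inner_expLp_mulOp, sub_neg_eq_add]
    rcases (Int.add_one_le_of_lt hn).lt_or_eq with hneg | hzero
    · exact_mod_cast f.2 (n + 1) hneg
    · have hcast : (n : ℝ) + 1 = (0 : ℕ) := by exact_mod_cast hzero
      rw [hcast]
      exact hf
  refine ⟨⟨_, hmem⟩, Subtype.ext ?_⟩
  rw [ContinuousLinearMap.coe_coe, coe_toeplitz_natCast, Nat.cast_one, ← mulOp_expLp_add,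
    add_neg_cancel, mulOp_expLp_zero]

theorem range_toeplitz_one_sup_span_hardyExp_zero :
    (toeplitz (expLp ∞ (1 : ℕ))).range ⊔ ℂ ∙ hardyExp 0 = ⊤ :=
  eq_top_mono (sup_le_sup_right orthogonal_span_hardyExp_zero_le_range_toeplitz_one _)
    (Submodule.isCompl_orthogonal _).symm.sup_eq_top

end ToeplitzAlgebra

section Injectivity

theorem eq_zero_of_mulOp_mem_orthogonal {f : Lp ℂ 2 intervalMeasure} (hf : f ∈ hardySpace)
    (h : mulOp (expLp ∞ (-(1 / 2))) f ∈ hardySpaceᗮ) : f = 0 := by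
  have horth (k : ℕ) : inner ℂ (expLp 2 (k + 1 / 2)) f = 0 := by
    simpa only [inner_expLp_mulOp, sub_neg_eq_add] using mem_orthogonal_hardySpace.1 h k
  have hint : Integrable (fun x => f x * f x) intervalMeasure :=
    (Lp.memLp f).integrable_mul (Lp.memLp f)
  have hsq := ae_eq_zero_of_integral_expFun_mul_eq_zero hint fun m => by
    rcases lt_or_ge 0 m with hm | hm
    · rw [← zero_add (m : ℝ)]
      refine integral_expFun_mul_mul_eq_zero 0 m fun n => ?_
      rcases lt_or_ge 0 n with hn | hn
      · left
        rw [sub_zero]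
        exact_mod_cast hf (-n) (by omega)
      · right
        exact_mod_cast hf (n - m) (by omega)
    · rw [← add_sub_cancel (-(1 / 2)) (m : ℝ)]
      refine integral_expFun_mul_mul_eq_zero _ _ fun n => ?_
      rcases lt_or_ge 0 n with hn | hn
      · right
        obtain ⟨k, hk⟩ := Int.eq_ofNat_of_zero_le (a := n - m - 1) (by omega)
        have hk_real : (n : ℝ) - m - 1 = k := by exact_mod_cast hk
        rw [← horth k, ← hk_real]
        ring_nf
      · left
        obtain ⟨k, rfl⟩ := Int.exists_eq_neg_ofNat hn
        simpa only [Int.cast_neg, Int.cast_natCast, neg_neg, sub_neg_eq_add] using horth k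
  rw [Lp.eq_zero_iff_ae_eq_zero]
  filter_upwards [hsq] with x hx
  exact mul_self_eq_zero.1 hx

theorem injective_toeplitz_neg_half : Function.Injective (toeplitz (expLp ∞ (-(1 / 2)))) := by
  rw [injective_iff_map_eq_zero]
  intro f hf
  rw [toeplitz_apply, hardySpace.orthogonalProjectionOnto_eq_zero_iff] at hf
  exact Subtype.ext (eq_zero_of_mulOp_mem_orthogonal f.2 hf)

theorem injective_toeplitz_neg_half_add (n : ℕ) :
    Function.Injective (toeplitz (expLp ∞ (-(1 / 2) + n))) := by
  rw [toeplitz_add_natCast, ContinuousLinearMap.coe_comp]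
  exact injective_toeplitz_neg_half.comp (injective_toeplitz_natCast n)

end Injectivity

section Invertibility

theorem isUnit_of_norm_one_sub_smul_lt_one {𝕜 R : Type*} [Field 𝕜] [NormedRing R] [Algebra 𝕜 R]
    [HasSummableGeomSeries R] {c : 𝕜} (hc : c ≠ 0) {a : R} (h : ‖1 - c • a‖ < 1) : IsUnit a := by
  have hunit := isUnit_one_sub_of_norm_lt_one h
  rw [sub_sub_cancel] at hunit
  exact (isUnit_smul_iff (Units.mk0 c hc) a).1 hunit

theorem isUnit_toeplitz_of_norm_sub_smul_lt_one {φ : Lp ℂ ∞ intervalMeasure} {c : ℂ} (hc : c ≠ 0)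
    (h : ‖expLp ∞ 0 - c • φ‖ < 1) : IsUnit (toeplitz φ) := by
  refine isUnit_of_norm_one_sub_smul_lt_one (R := hardySpace →L[ℂ] hardySpace) hc ?_
  rw [← toeplitz_expLp_zero, ← toeplitz_smul, ← toeplitz_sub]
  exact (norm_toeplitz_le _).trans_lt h

theorem norm_one_sub_cos_mul_expFun_le {ξ x : ℝ} (hξ : |ξ| ≤ 1 / 2) (hx : |x| ≤ 1 / 2) :
    ‖1 - Real.cos (Real.pi * ξ) * expFun ξ x‖ ≤ |Real.sin (Real.pi * ξ)| := by
  have hpi := Real.pi_pos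
  have hmul : |2 * Real.pi * ξ * x| ≤ |Real.pi * ξ| := by
    rw [show 2 * Real.pi * ξ * x = Real.pi * ξ * (2 * x) by ring, abs_mul, abs_mul 2, abs_two]
    exact mul_le_of_le_one_right (abs_nonneg _) (by linarith)
  have hle : |Real.pi * ξ| ≤ Real.pi / 2 := by
    rw [abs_mul, abs_of_pos hpi]
    nlinarith
  have hcos : Real.cos (Real.pi * ξ) ≤ Real.cos (2 * Real.pi * ξ * x) := by
    rw [← Real.cos_abs (Real.pi * ξ), ← Real.cos_abs (2 * Real.pi * ξ * x)]
    exact Real.cos_le_cos_of_nonneg_of_le_pi (abs_nonneg _) (by linarith) hmul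
  have hcos_nonneg : 0 ≤ Real.cos (Real.pi * ξ) :=
    Real.cos_nonneg_of_mem_Icc (abs_le.1 hle)
  have hnorm_sq : ‖1 - Real.cos (Real.pi * ξ) * expFun ξ x‖ ^ 2
      = 1 - 2 * (Real.cos (Real.pi * ξ) * Real.cos (2 * Real.pi * ξ * x))
        + Real.cos (Real.pi * ξ) ^ 2 := by
    rw [expFun_eq_exp_mul_I, Complex.sq_norm, Complex.normSq_apply]
    simp only [Complex.sub_re, Complex.sub_im, Complex.one_re, Complex.one_im,
      Complex.re_ofReal_mul, Complex.im_ofReal_mul, Complex.exp_ofReal_mul_I_re,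
      Complex.exp_ofReal_mul_I_im]
    linear_combination Real.cos (Real.pi * ξ) ^ 2 * Real.sin_sq_add_cos_sq (2 * Real.pi * ξ * x)
  rw [← sq_le_sq₀ (norm_nonneg _) (abs_nonneg _), sq_abs, Real.sin_sq, hnorm_sq]
  linarith [mul_le_mul_of_nonneg_left hcos hcos_nonneg, sq (Real.cos (Real.pi * ξ))]

theorem isUnit_toeplitz_expLp {ξ : ℝ} (hξ_gt : -(1 / 2) < ξ) (hξ_lt : ξ < 1 / 2) :
    IsUnit (toeplitz (expLp ∞ ξ)) := by
  have hpi := Real.pi_pos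
  have hcos : 0 < Real.cos (Real.pi * ξ) :=
    Real.cos_pos_of_mem_Ioo ⟨by nlinarith, by nlinarith⟩
  have hsin : |Real.sin (Real.pi * ξ)| < 1 := by
    rw [← sq_lt_one_iff_abs_lt_one, Real.sin_sq]
    nlinarith
  refine isUnit_toeplitz_of_norm_sub_smul_lt_one (Complex.ofReal_ne_zero.2 hcos.ne')
    ((norm_expLp_sub_smul_expLp_le (abs_nonneg _) fun x hx => ?_).trans_lt hsin)
  rw [expFun_zero]
  exact norm_one_sub_cos_mul_expFun_le (abs_le.2 ⟨hξ_gt.le, hξ_lt.le⟩) (abs_le.2 hx)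

end Invertibility

section BoundedBelow

variable {H : Type*} [NormedAddCommGroup H] [NormedSpace ℂ H] {A S T : H →L[ℂ] H}

theorem normBoundedBelow_iff_exists_antilipschitzWith :
    NormBoundedBelow T ↔ ∃ K, AntilipschitzWith K T :=
  antilipschitzWith_iff_exists_mul_le_norm.symm

theorem NormBoundedBelow.comp (hA : NormBoundedBelow A) (hS : NormBoundedBelow S) :
    NormBoundedBelow (A ∘L S) := by
  rw [normBoundedBelow_iff_exists_antilipschitzWith] at *
  obtain ⟨K, hK⟩ := hA
  obtain ⟨L, hL⟩ := hS
  exact ⟨_, hK.comp hL⟩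

theorem normBoundedBelow_of_isUnit (hT : IsUnit T) : NormBoundedBelow T := by
  obtain ⟨u, rfl⟩ := hT
  exact normBoundedBelow_iff_exists_antilipschitzWith.2
    ⟨_, (ContinuousLinearEquiv.ofUnit u).antilipschitz⟩

theorem bijective_of_isUnit (hT : IsUnit T) : Function.Bijective T := by
  obtain ⟨u, rfl⟩ := hT
  exact (ContinuousLinearEquiv.ofUnit u).bijective

theorem NormBoundedBelow.eventually_injective (hT : NormBoundedBelow T) :
    ∀ᶠ S : H →L[ℂ] H in 𝓝 T, Function.Injective S := by
  obtain ⟨c, hc, hbound⟩ := hT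
  filter_upwards [Metric.ball_mem_nhds T hc] with S hS
  rw [injective_iff_map_eq_zero]
  intro f hf
  by_contra hne
  rw [Metric.mem_ball, dist_eq_norm_sub'] at hS
  refine (hbound f).not_gt ?_
  calc ‖T f‖ = ‖(T - S) f‖ := by rw [sub_apply, hf, sub_zero]
    _ ≤ ‖T - S‖ * ‖f‖ := (T - S).le_opNorm f
    _ < c * ‖f‖ := by gcongr

theorem normBoundedBelow_iff_isClosed_range [CompleteSpace H] (hT : Function.Injective T) :
    NormBoundedBelow T ↔ IsClosed (range T) :=
  normBoundedBelow_iff_exists_antilipschitzWith.trans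
    (T.isClosed_range_iff_antilipschitz_of_injective hT).symm

theorem NormBoundedBelow.of_comp [CompleteSpace H] (hA : Function.Injective A)
    (hAS : NormBoundedBelow (A ∘L S)) {W : Submodule ℂ H} [FiniteDimensional ℂ W]
    (hSW : S.range ⊔ W = ⊤) : NormBoundedBelow A := by
  obtain ⟨K, hK⟩ := normBoundedBelow_iff_exists_antilipschitzWith.1 hAS
  have hclosed : IsClosed ((A ∘L S).range : Set H) :=
    hK.isClosed_range (A ∘L S).uniformContinuous
  have hrange : A.range = (A ∘L S).range ⊔ W.map A.toLinearMap := by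
    rw [ContinuousLinearMap.toLinearMap_comp, LinearMap.range_comp, ← Submodule.map_sup, hSW,
      LinearMap.range_eq_map]
  rw [normBoundedBelow_iff_isClosed_range hA, ← ContinuousLinearMap.coe_coe, ← LinearMap.coe_range,
    hrange]
  exact Submodule.isClosed_sup_finiteDimensional _ _ hclosed

theorem normBoundedBelow_toeplitz_natCast (n : ℕ) : NormBoundedBelow (toeplitz (expLp ∞ n)) :=
  ⟨1, one_pos, fun f => by rw [one_mul, norm_toeplitz_natCast]⟩

end BoundedBelow

section BoundaryValues

variable {F : ℂ → ℂ}

theorem integral_expFun_natCast_mul_comp_expFun_one (hF : DiffContOnCl ℂ F (Metric.ball 0 1))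
    (k : ℕ) : ∫ x, expFun k x * F (expFun 1 x) ∂intervalMeasure = 0 ^ k * F 0 := by
  have hmul : DiffContOnCl ℂ (fun z => z ^ k * F z) (Metric.ball 0 |1|) := by
    rw [abs_one]
    exact (differentiable_id.pow k).diffContOnCl.smul hF
  simp_rw [expFun_natCast]
  rw [integral_comp_expFun_one fun z => z ^ k * F z, hmul.circleAverage]

theorem memLp_comp_expFun_one (hF : ContinuousOn F (Metric.closedBall 0 1)) :
    MemLp (fun x => F (expFun 1 x)) 2 intervalMeasure := by
  have hmem (x : ℝ) : expFun 1 x ∈ Metric.closedBall 0 1 := by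
    rw [mem_closedBall_zero_iff, norm_expFun]
  obtain ⟨C, hC⟩ := (isCompact_closedBall (0 : ℂ) 1).exists_bound_of_continuousOn hF
  exact MemLp.of_bound (hF.comp_continuous (continuous_expFun 1) hmem).aestronglyMeasurable C
    (.of_forall fun x => hC _ (hmem x))

theorem inner_expLp_toLp_comp_expFun_one (hF : ContinuousOn F (Metric.closedBall 0 1)) (ξ : ℝ) :
    inner ℂ (expLp 2 ξ) ((memLp_comp_expFun_one hF).toLp _)
      = ∫ x, expFun (-ξ) x * F (expFun 1 x) ∂intervalMeasure := by
  rw [inner_expLp]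
  apply integral_congr_ae
  filter_upwards [(memLp_comp_expFun_one hF).coeFn_toLp] with x hx
  rw [hx]

/-- The boundary values `x ↦ F(e^{2πix})` of a function `F` in the disc algebra, as an element of
the Hardy space. -/
noncomputable def boundaryLp (F : ℂ → ℂ) (hF : DiffContOnCl ℂ F (Metric.ball 0 1)) : hardySpace :=
  ⟨(memLp_comp_expFun_one hF.continuousOn_ball).toLp _, fun n hn => by
    obtain ⟨k, rfl⟩ := Int.exists_eq_neg_ofNat hn.le
    rw [inner_expLp_toLp_comp_expFun_one hF.continuousOn_ball, Int.cast_neg, neg_neg,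
      Int.cast_natCast, integral_expFun_natCast_mul_comp_expFun_one hF, zero_pow (by omega),
      zero_mul]⟩

theorem boundaryLp_ne_zero (hF : DiffContOnCl ℂ F (Metric.ball 0 1)) (hF0 : F 0 ≠ 0) :
    boundaryLp F hF ≠ 0 := by
  intro hzero
  refine hF0 ?_
  calc F 0 = ∫ x, expFun (-0) x * F (expFun 1 x) ∂intervalMeasure := by
        simpa using (integral_expFun_natCast_mul_comp_expFun_one hF 0).symm
    _ = inner ℂ (expLp 2 0) (boundaryLp F hF : Lp ℂ 2 intervalMeasure) :=
        (inner_expLp_toLp_comp_expFun_one hF.continuousOn_ball _).symm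
    _ = 0 := by rw [hzero, Submodule.coe_zero, inner_zero_right]

theorem toeplitz_boundaryLp_eq_zero (hF : DiffContOnCl ℂ F (Metric.ball 0 1)) {ξ : ℝ}
    (hconj : ∀ᵐ x ∂intervalMeasure,
      expFun (ξ + 1) x * F (expFun 1 x) = starRingEnd ℂ (F (expFun 1 x))) :
    toeplitz (expLp ∞ ξ) (boundaryLp F hF) = 0 := by
  refine toeplitz_expLp_eq_zero_iff.2 fun n => ?_
  calc inner ℂ (expLp 2 (n - ξ)) (boundaryLp F hF : Lp ℂ 2 intervalMeasure)
      = ∫ x, expFun (-(n - ξ)) x * F (expFun 1 x) ∂intervalMeasure :=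
        inner_expLp_toLp_comp_expFun_one hF.continuousOn_ball _
    _ = ∫ x, starRingEnd ℂ (expFun (n + 1 : ℕ) x * F (expFun 1 x)) ∂intervalMeasure := by
        refine integral_congr_ae ?_
        filter_upwards [hconj] with x hx
        rw [map_mul, ← hx, conj_expFun, ← mul_assoc, ← expFun_add]
        congr 2
        push_cast
        ring
    _ = 0 := by
        rw [integral_conj, integral_expFun_natCast_mul_comp_expFun_one hF,
          zero_pow n.succ_ne_zero, zero_mul, map_zero]

end BoundaryValues

section Kernel

theorem one_add_expFun_one (x : ℝ) :
    1 + expFun 1 x = (2 * Real.cos (Real.pi * x) : ℝ) * expFun (1 / 2) x := by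
  have hcos : ((2 * Real.cos (Real.pi * x) : ℝ) : ℂ) = expFun (1 / 2) x + expFun (-(1 / 2)) x := by
    rw [expFun_eq_exp_mul_I, expFun_eq_exp_mul_I, Complex.ofReal_mul, Complex.ofReal_cos,
      Complex.ofReal_ofNat, Complex.two_cos]
    congr 3
    · push_cast
      ring
    · push_cast
      ring
  rw [hcos, add_mul, ← expFun_add, ← expFun_add, neg_add_cancel, expFun_zero, add_halves, add_comm]

theorem two_mul_cos_pi_mul_pos {x : ℝ} (hx : x ∈ Ioo (-(1 / 2) : ℝ) (1 / 2)) :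
    0 < 2 * Real.cos (Real.pi * x) :=
  mul_pos two_pos (Real.cos_pos_of_mem_Ioo
    ⟨by nlinarith [hx.1, Real.pi_pos], by nlinarith [hx.2, Real.pi_pos]⟩)

theorem one_add_expFun_one_ne_zero {x : ℝ} (hx : x ∈ Ioo (-(1 / 2) : ℝ) (1 / 2)) :
    1 + expFun 1 x ≠ 0 := by
  rw [one_add_expFun_one]
  exact mul_ne_zero (Complex.ofReal_ne_zero.2 (two_mul_cos_pi_mul_pos hx).ne')
    (Complex.exp_ne_zero _)

theorem log_one_add_expFun_one {x : ℝ} (hx : x ∈ Ioo (-(1 / 2) : ℝ) (1 / 2)) :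
    Complex.log (1 + expFun 1 x)
      = Real.log (2 * Real.cos (Real.pi * x)) + (Real.pi * x : ℝ) * Complex.I := by
  have hexp : expFun (1 / 2) x = Complex.exp ((Real.pi * x : ℝ) * Complex.I) := by
    rw [expFun_eq_exp_mul_I]
    ring_nf
  rw [one_add_expFun_one, hexp,
    Complex.log_ofReal_mul (two_mul_cos_pi_mul_pos hx) (Complex.exp_ne_zero _), Complex.log_exp]
  · rw [Complex.im_ofReal_mul, Complex.I_im]
    nlinarith [hx.1, Real.pi_pos]
  · rw [Complex.im_ofReal_mul, Complex.I_im]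
    nlinarith [hx.2, Real.pi_pos]

theorem one_add_expFun_one_cpow (s : ℝ) {x : ℝ} (hx : x ∈ Ioo (-(1 / 2) : ℝ) (1 / 2)) :
    (1 + expFun 1 x) ^ (s : ℂ)
      = Real.exp (s * Real.log (2 * Real.cos (Real.pi * x))) * expFun (s / 2) x := by
  rw [Complex.cpow_def_of_ne_zero (one_add_expFun_one_ne_zero hx), log_one_add_expFun_one hx,
    Complex.ofReal_exp, expFun, ← Complex.exp_add]
  congr 1
  push_cast
  ring

theorem expFun_neg_mul_one_add_expFun_one_cpow (s : ℝ) {x : ℝ}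
    (hx : x ∈ Ioo (-(1 / 2) : ℝ) (1 / 2)) :
    expFun (-s) x * (1 + expFun 1 x) ^ (s : ℂ)
      = starRingEnd ℂ ((1 + expFun 1 x) ^ (s : ℂ)) := by
  rw [one_add_expFun_one_cpow s hx, map_mul, Complex.conj_ofReal, conj_expFun, mul_left_comm,
    ← expFun_add]
  ring_nf

theorem diffContOnCl_one_add_cpow {s : ℂ} (hs : 0 < s.re) :
    DiffContOnCl ℂ (fun z : ℂ => (1 + z) ^ s) (Metric.ball 0 1) where
  differentiableOn z hz :=
    ((differentiableAt_id.const_add 1).cpow_const (Complex.mem_slitPlane_of_norm_lt_one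
      (mem_ball_zero_iff.1 hz))).differentiableWithinAt
  continuousOn z hz := by
    rw [closure_ball _ one_ne_zero, mem_closedBall_zero_iff] at hz
    have hre : 0 ≤ (1 + z).re := by
      rw [Complex.add_re, Complex.one_re]
      linarith [neg_le_of_abs_le ((Complex.abs_re_le_norm z).trans hz)]
    exact ((Complex.continuousAt_cpow_const_of_re_pos (.inl hre) hs).comp
      (f := fun z : ℂ => 1 + z) (by fun_prop)).continuousWithinAt

theorem not_injective_toeplitz_of_lt_neg_one {ξ : ℝ} (hξ : ξ < -1) :
    ¬ Function.Injective (toeplitz (expLp ∞ ξ)) := by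
  set F : ℂ → ℂ := fun z => (1 + z) ^ ((-(ξ + 1) : ℝ) : ℂ) with hF_def
  have hF : DiffContOnCl ℂ F (Metric.ball 0 1) :=
    diffContOnCl_one_add_cpow (by rw [Complex.ofReal_re]; linarith)
  have hF0 : F 0 ≠ 0 := by simp [hF_def]
  have hkernel : toeplitz (expLp ∞ ξ) (boundaryLp F hF) = 0 := by
    refine toeplitz_boundaryLp_eq_zero hF ?_
    rw [intervalMeasure, ← restrict_Ioo_eq_restrict_Icc]
    filter_upwards [ae_restrict_mem measurableSet_Ioo] with x hx
    simpa only [neg_neg] using expFun_neg_mul_one_add_expFun_one_cpow (-(ξ + 1)) hx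
  exact fun hinj => boundaryLp_ne_zero hF hF0 ((injective_iff_map_eq_zero _).1 hinj _ hkernel)

theorem toeplitz_neg_one_hardyExp_zero : toeplitz (expLp ∞ (-(1 : ℕ))) (hardyExp 0) = 0 := by
  refine toeplitz_expLp_eq_zero_iff.2 fun n => ?_
  rw [sub_neg_eq_add]
  exact_mod_cast orthonormal_expLp.2 (i := n + 1) (j := (0 : ℕ)) (by omega)

theorem not_injective_toeplitz_of_lt {ξ : ℝ} (hξ : ξ < -(1 / 2)) :
    ¬ Function.Injective (toeplitz (expLp ∞ ξ)) := by
  rcases lt_or_ge ξ (-1) with hlt | hge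
  · exact not_injective_toeplitz_of_lt_neg_one hlt
  · intro hinj
    have hunit : IsUnit (toeplitz (expLp ∞ (ξ + 1))) :=
      isUnit_toeplitz_expLp (by linarith) (by linarith)
    have hinj_neg_one : Function.Injective (toeplitz (expLp ∞ (-(1 : ℕ)))) := by
      refine Function.Injective.of_comp_right ?_ (bijective_of_isUnit hunit).surjective
      rw [← ContinuousLinearMap.coe_comp, ← toeplitz_neg_natCast_add, Nat.cast_one,
        neg_add_cancel_comm_assoc]
      exact hinj
    exact hardyExp_ne_zero 0
      ((injective_iff_map_eq_zero _).1 hinj_neg_one _ toeplitz_neg_one_hardyExp_zero)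

end Kernel

section HalfIntegers

theorem not_normBoundedBelow_toeplitz_neg_half :
    ¬ NormBoundedBelow (toeplitz (expLp ∞ (-(1 / 2)))) := by
  intro hbound
  have hinj : ∀ᶠ ξ in 𝓝 (-(1 / 2) : ℝ), Function.Injective (toeplitz (expLp ∞ ξ)) :=
    (continuous_toeplitz.comp continuous_expLp_top).continuousAt.eventually
      hbound.eventually_injective
  obtain ⟨ξ, hξ_inj, hξ⟩ :=
    ((hinj.filter_mono nhdsWithin_le_nhds).and (self_mem_nhdsWithin (s := Iio (-(1 / 2))))).exists
  exact not_injective_toeplitz_of_lt hξ hξ_inj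

theorem not_normBoundedBelow_toeplitz_neg_half_add (n : ℕ) :
    ¬ NormBoundedBelow (toeplitz (expLp ∞ (-(1 / 2) + n))) := by
  induction n with
  | zero =>
    rw [Nat.cast_zero, add_zero]
    exact not_normBoundedBelow_toeplitz_neg_half
  | succ n ih =>
    rw [Nat.cast_add, ← add_assoc, toeplitz_add_natCast]
    exact fun hbound => ih (hbound.of_comp (injective_toeplitz_neg_half_add n)
      range_toeplitz_one_sup_span_hardyExp_zero)

theorem exists_natCast_add_of_half_lt {ξ : ℝ} (hξ : 1 / 2 < ξ) (hne : ∀ n : ℕ, ξ ≠ -(1 / 2) + n) :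
    ∃ (n : ℕ) (α : ℝ), 0 < n ∧ -(1 / 2) < α ∧ α < 1 / 2 ∧ ξ = α + n := by
  have hfloor_le := Nat.floor_le (a := ξ + 1 / 2) (by linarith)
  have hlt_floor := Nat.lt_floor_add_one (ξ + 1 / 2)
  refine ⟨⌊ξ + 1 / 2⌋₊, ξ - ⌊ξ + 1 / 2⌋₊, Nat.floor_pos.2 (by linarith), ?_, by linarith, by ring⟩
  exact lt_of_le_of_ne (by linarith) fun heq => hne ⌊ξ + 1 / 2⌋₊ (by linarith)

end HalfIntegers

end ToeplitzExp

theorem mainTheorem4 (ξ : ℝ) :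
    (ξ < -(1 / 2) →
      ¬ Function.Injective (ToeplitzExp.toeplitz (ToeplitzExp.expLp ∞ ξ))) ∧
    (-(1 / 2) < ξ → ξ < 1 / 2 →
      IsUnit (ToeplitzExp.toeplitz (ToeplitzExp.expLp ∞ ξ))) ∧
    ((∃ n : ℕ, ξ = -(1 / 2) + n) →
      Function.Injective (ToeplitzExp.toeplitz (ToeplitzExp.expLp ∞ ξ)) ∧
      ¬ ToeplitzExp.NormBoundedBelow (ToeplitzExp.toeplitz (ToeplitzExp.expLp ∞ ξ))) ∧
    (1 / 2 < ξ → (∀ n : ℕ, ξ ≠ -(1 / 2) + n) →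
      Function.Injective (ToeplitzExp.toeplitz (ToeplitzExp.expLp ∞ ξ)) ∧
      ToeplitzExp.NormBoundedBelow (ToeplitzExp.toeplitz (ToeplitzExp.expLp ∞ ξ)) ∧
      ¬ Function.Surjective (ToeplitzExp.toeplitz (ToeplitzExp.expLp ∞ ξ))) := by
  open ToeplitzExp in
  refine ⟨not_injective_toeplitz_of_lt, isUnit_toeplitz_expLp, ?_, fun hξ hne => ?_⟩
  · rintro ⟨n, rfl⟩
    exact ⟨injective_toeplitz_neg_half_add n, not_normBoundedBelow_toeplitz_neg_half_add n⟩
  · obtain ⟨n, α, hn, hα_gt, hα_lt, rfl⟩ := exists_natCast_add_of_half_lt hξ hne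
    have hunit : IsUnit (toeplitz (expLp ∞ α)) := isUnit_toeplitz_expLp hα_gt hα_lt
    have hbij := bijective_of_isUnit hunit
    rw [toeplitz_add_natCast]
    refine ⟨hbij.injective.comp (injective_toeplitz_natCast n),
      (normBoundedBelow_of_isUnit hunit).comp (normBoundedBelow_toeplitz_natCast n),
      fun hsurj => ?_⟩
    rw [ContinuousLinearMap.coe_comp] at hsurj
    exact not_surjective_toeplitz_natCast hn (hsurj.of_comp_left hbij.injective)
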